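/- All Hilbert spaces are finite-dimensional. Let $A,B$ be Hilbert spaces with fixed orthonormal bases, that of $A$ being $\{|a\rangle\}_{a\in[d_A]}$. For a Hilbert space $\mathcal H$, an extension of a density operator $\rho_{AB}$ on $A\otimes B$ is a density operator $\rho_{AB\mathcal H}$ on $A\otimes B\otimes\mathcal H$ with $\mathrm{tr}_{\mathcal H}\,\rho_{AB\mathcal H}=\rho_{AB}$; subscripts denote marginals, e.g. $\rho_{A\mathcal H}=\mathrm{tr}_B\,\rho_{AB\mathcal H}$. For continuous $f:(0,\infty)\to\mathbb R$ with $f(0^+):=\lim_{x\to0^+}f(x)\in[-\infty,\infty]$, and positive semidefinite $\rho=\sum_j\lambda_jP_j$, $\sigma=\sum_k\mu_kQ_k$ (spectral decompositions), let $$D_f(\rho\|\sigma):=\sum_{j:\lambda_j>0}\ \sum_{k:\mu_k>0}\lambda_j\,f(\mu_k\lambda_j^{-1})\,\mathrm{tr}(P_jQ_k)+f(0^+)\,\mathrm{tr}\big(\rho(I-\sigma^0)\big),$$ where $\sigma^0$ is the projector onto the support of $\sigma$ and $\pm\infty\cdot 0=0$. Let $m\ge1$, let $t_1,\dots,t_m\in(0,1]$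 be nodes and $w_1,\dots,w_m>0$ weights (for example those of the Gauss--Radau quadrature of the logarithm), and let $$r_m(x):=\sum_{i=1}^m w_i\,\frac{x-1}{t_i(x-1)+1},\qquad f:=-\frac{r_m}{\ln 2},$$ $$E_{\mathrm{sq}}^{(m)}(A:B)_\rho:=\tfrac12\inf_{\rho_{ABDE}}\Big(-D_f(\rho_{AD}\|I_A\otimes\rho_D)-D_f(\rho_{AE}\|I_A\otimes\rho_E)\Big),$$ where the infimum is over all Hilbert spaces $D,E$ and all extensions $\rho_{ABDE}$ of $\rho_{AB}$. For noncommuting variables ${\bf Z}=\{Z_i[a_1,a_2],Z_i[a_1,a_2]^*\}_{i\in[m],\,a_1,a_2\in[d_A]}$ define the $d_A\times d_A$ matrix-valued polynomial ${\bf P}^{(m)}({\bf Z}):=\big(\sum_{i=1}^mP^i_{a_1,a_2}({\bf Z})\big)_{a_1,a_2}$ by $$P^i_{a_1,a_2}({\bf Z})=\frac{w_i}{t_i\ln2}\Big(Z_i[a_1,a_2]+Z_i[a_2,a_1]^*+(1-t_i)\sum_{a_3}Z_i[a_3,a_1]^*Z_i[a_3,a_2]+\delta_{a_1=a_2}\big(1+t_i\sum_{a_3,a_4}Z_i[a_3,a_4]Z_i[a_3,a_4]^*\big)\Big).$$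 Theorem. When the variables $Z_i[a_1,a_2]$ are replaced by operators on a Hilbert space $\mathcal H$, ${\bf P}^{(m)}({\bf Z})$ is a Hermitian operator on $A\otimes\mathcal H$. For every density operator $\rho_{AB}$ on $A\otimes B$, $$E_{\mathrm{sq}}^{(m)}(A:B)_\rho=\inf\ \mathrm{tr}\Big(\rho_{A\mathcal H}\,\frac{{\bf P}^{(m)}({\bf Z})+{\bf P}^{(m)}({\bf Y})}{2}\Big),$$ where the infimum is over Hilbert spaces $\mathcal H$, extensions $\rho_{AB\mathcal H}$ of $\rho_{AB}$, and pairs of families ${\bf Z}=\{Z_i[a_1,a_2]\}$ and ${\bf Y}=\{Y_i[a_1,a_2]\}$ of operators on $\mathcal H$ that mutually commute, i.e. $[Y_i[a_1,a_2],Z_j[a_3,a_4]]=[Y_i[a_1,a_2],Z_j[a_3,a_4]^*]=0$ for all indices. -/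

import Mathlib

open scoped ComplexOrder Kronecker

namespace SqEnt

noncomputable section

/-! Finite-dimensional Hilbert spaces are represented in a fixed orthonormal basis: an operator on the
space with orthonormal basis indexed by `ι` is a matrix `Matrix ι ι ℂ`, and the tensor product of the
spaces indexed by `ι` and `κ` is indexed by `ι × κ`. -/

/-- Density operators: positive semidefinite with unit trace. -/
def IsDensity {ι : Type*} [Fintype ι] (ρ : Matrix ι ι ℂ) : Prop :=
  ρ.PosSemidef ∧ ρ.trace = 1

/-- Partial trace over the second tensor factor. -/
def traceRight {ι κ : Type*} [Fintype κ] (ρ : Matrix (ι × κ) (ι × κ) ℂ) : Matrix ι ι ℂ :=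
  Matrix.of fun i j => ∑ k, ρ (i, k) (j, k)

/-- Partial trace over the first tensor factor. -/
def traceLeft {ι κ : Type*} [Fintype ι] (ρ : Matrix (ι × κ) (ι × κ) ℂ) : Matrix κ κ ℂ :=
  Matrix.of fun k l => ∑ i, ρ (i, k) (i, l)

/-- `ω` is an extension of `ρ_AB` : a density operator on `(A ⊗ B) ⊗ H` with `tr_H ω = ρ_AB`. -/
def IsExtension {A B H : Type*} [Fintype A] [Fintype B] [Fintype H]
    (ρ : Matrix (A × B) (A × B) ℂ) (ω : Matrix ((A × B) × H) ((A × B) × H) ℂ) : Prop :=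
  IsDensity ω ∧ traceRight ω = ρ

/-- The marginal `ω_AH = tr_B ω_ABH`. -/
def marginalAH {A B H : Type*} [Fintype B] (ω : Matrix ((A × B) × H) ((A × B) × H) ℂ) :
    Matrix (A × H) (A × H) ℂ :=
  traceRight (ω.submatrix (fun p : (A × H) × B => ((p.1.1, p.2), p.1.2))
    (fun p : (A × H) × B => ((p.1.1, p.2), p.1.2)))

/-- The marginal `ω_AD` of `ω_ABDE`. -/
def marginalAD {A B D E : Type*} [Fintype B] [Fintype E]
    (ω : Matrix ((A × B) × (D × E)) ((A × B) × (D × E)) ℂ) : Matrix (A × D) (A × D) ℂ :=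
  traceRight ((marginalAH ω).submatrix (fun p : (A × D) × E => (p.1.1, (p.1.2, p.2)))
    (fun p : (A × D) × E => (p.1.1, (p.1.2, p.2))))

/-- The marginal `ω_AE` of `ω_ABDE`. -/
def marginalAE {A B D E : Type*} [Fintype B] [Fintype D]
    (ω : Matrix ((A × B) × (D × E)) ((A × B) × (D × E)) ℂ) : Matrix (A × E) (A × E) ℂ :=
  traceRight ((marginalAH ω).submatrix (fun p : (A × E) × D => (p.1.1, (p.2, p.1.2)))
    (fun p : (A × E) × D => (p.1.1, (p.2, p.1.2))))

theorem traceRight_posSemidef {ι κ : Type*} [Fintype κ] {ρ : Matrix (ι × κ) (ι × κ) ℂ}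
    (h : ρ.PosSemidef) : (traceRight ρ).PosSemidef := by
  have e : traceRight ρ = ∑ k, ρ.submatrix (fun i => (i, k)) (fun i => (i, k)) := by
    ext i j
    simp [traceRight, Matrix.sum_apply]
  rw [e]
  exact Matrix.posSemidef_sum _ fun k _ => h.submatrix _

theorem traceLeft_posSemidef {ι κ : Type*} [Fintype ι] {ρ : Matrix (ι × κ) (ι × κ) ℂ}
    (h : ρ.PosSemidef) : (traceLeft ρ).PosSemidef := by
  have e : traceLeft ρ = ∑ i, ρ.submatrix (fun k => (i, k)) (fun k => (i, k)) := by
    ext i j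
    simp [traceLeft, Matrix.sum_apply]
  rw [e]
  exact Matrix.posSemidef_sum _ fun k _ => h.submatrix _

theorem marginalAD_posSemidef {A B D E : Type*} [Fintype B] [Fintype E]
    {ω : Matrix ((A × B) × (D × E)) ((A × B) × (D × E)) ℂ} (h : ω.PosSemidef) :
    (marginalAD ω).PosSemidef :=
  traceRight_posSemidef ((traceRight_posSemidef (h.submatrix _)).submatrix _)

theorem marginalAE_posSemidef {A B D E : Type*} [Fintype B] [Fintype D]
    {ω : Matrix ((A × B) × (D × E)) ((A × B) × (D × E)) ℂ} (h : ω.PosSemidef) :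
    (marginalAE ω).PosSemidef :=
  traceRight_posSemidef ((traceRight_posSemidef (h.submatrix _)).submatrix _)

theorem one_kronecker_posSemidef {A D : Type*} [Fintype A] [DecidableEq A] [Fintype D]
    {σ : Matrix D D ℂ} (h : σ.PosSemidef) : ((1 : Matrix A A ℂ) ⊗ₖ σ).PosSemidef :=
  Matrix.PosSemidef.one.kronecker h

/-- The rank-one spectral projections `P_j = |u_j⟩⟨u_j|` of a Hermitian matrix for an orthonormal basis
`u_j` of eigenvectors, so that `ρ = ∑ j, λ_j P_j` with `λ_j = hρ.eigenvalues j`. -/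
def specProj {ι : Type*} [Fintype ι] [DecidableEq ι] {ρ : Matrix ι ι ℂ} (hρ : ρ.IsHermitian)
    (j : ι) : Matrix ι ι ℂ :=
  Matrix.vecMulVec (fun x => hρ.eigenvectorBasis j x) (fun y => star (hρ.eigenvectorBasis j y))

/-- The projector `σ⁰` onto the support of a positive semidefinite matrix `σ`. -/
def suppProj {ι : Type*} [Fintype ι] [DecidableEq ι] {σ : Matrix ι ι ℂ} (hσ : σ.IsHermitian) :
    Matrix ι ι ℂ :=
  ∑ k, if 0 < hσ.eigenvalues k then specProj hσ k else 0

/-- The limit `f(0⁺)`, which may be infinite. -/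
def atZeroPlus (f : ℝ → ℝ) : EReal :=
  Filter.limUnder (nhdsWithin (0 : ℝ) (Set.Ioi 0)) (fun x => (f x : EReal))

/-- The standard `f`-divergence
`D_f(ρ‖σ) = ∑_{λ_j > 0} ∑_{μ_k > 0} λ_j f(μ_k / λ_j) tr(P_j Q_k) + f(0⁺) tr(ρ (I - σ⁰))`
(only the values of `f` on `(0,∞)` matter; in `EReal` one has `±∞ * 0 = 0`). -/
def fDiv {ι : Type*} [Fintype ι] [DecidableEq ι] (f : ℝ → ℝ) {ρ σ : Matrix ι ι ℂ}
    (hρ : ρ.PosSemidef) (hσ : σ.PosSemidef) : EReal :=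
  ((∑ j, ∑ k, if 0 < hρ.1.eigenvalues j ∧ 0 < hσ.1.eigenvalues k then
      hρ.1.eigenvalues j * f (hσ.1.eigenvalues k * (hρ.1.eigenvalues j)⁻¹) *
        (specProj hρ.1 j * specProj hσ.1 k).trace.re
    else 0 : ℝ) : EReal) +
  atZeroPlus f * (((ρ * (1 - suppProj hσ.1)).trace.re : ℝ) : EReal)

/-- For a positive semidefinite `τ` on `A ⊗ D` : the quantity `D_f(τ ‖ I_A ⊗ tr_A τ)`. -/
def condDiv {A D : Type*} [Fintype A] [DecidableEq A] [Fintype D] [DecidableEq D] (f : ℝ → ℝ)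
    {τ : Matrix (A × D) (A × D) ℂ} (hτ : τ.PosSemidef) : EReal :=
  fDiv f hτ (one_kronecker_posSemidef (A := A) (traceLeft_posSemidef hτ))

/-- The `f`-squashed entanglement: half the infimum, over all finite-dimensional `D`, `E` and all
extensions `ω_ABDE` of `ρ_AB`, of `- D_f(ω_AD ‖ I_A ⊗ ω_D) - D_f(ω_AE ‖ I_A ⊗ ω_E)`. -/
def fSquashed {A B : Type*} [Fintype A] [DecidableEq A] [Fintype B]
    (f : ℝ → ℝ) (ρ : Matrix (A × B) (A × B) ℂ) : EReal :=
  ((1 / 2 : ℝ) : EReal) *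
    ⨅ (dD : ℕ) (dE : ℕ)
      (ω : Matrix ((A × B) × (Fin dD × Fin dE)) ((A × B) × (Fin dD × Fin dE)) ℂ)
      (h : IsExtension ρ ω),
      (- condDiv f (marginalAD_posSemidef h.1.1) - condDiv f (marginalAE_posSemidef h.1.1))

/-- `f_t(x) = (x - 1) / (t (x - 1) + 1)`. -/
def fNode (t x : ℝ) : ℝ := (x - 1) / (t * (x - 1) + 1)

/-- `r_m(x) = ∑ i, w_i f_{t_i}(x)`. -/
def rQuad {m : ℕ} (t w : Fin m → ℝ) (x : ℝ) : ℝ := ∑ i, w i * fNode (t i) x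

/-- `E_sq^(m)`, the `f`-squashed entanglement for `f = - r_m / ln 2`, where `r_m` has nodes `t` and
weights `w`. -/
def mSquashed {A B : Type*} [Fintype A] [DecidableEq A] [Fintype B] {m : ℕ} (t w : Fin m → ℝ)
    (ρ : Matrix (A × B) (A × B) ℂ) : EReal :=
  fSquashed (fun x => - (rQuad t w x / Real.log 2)) ρ

/-- The noncommutative polynomial `P^i_{a₁,a₂}`, with the variables `Z_i[a,a']` and their adjoints
evaluated in an arbitrary star-algebra `R`. -/
def polyEntry {A R : Type*} [Fintype A] [DecidableEq A] [Ring R] [StarRing R] [Algebra ℝ R]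
    {m : ℕ} (t w : Fin m → ℝ) (Z : Fin m → A → A → R) (i : Fin m) (a₁ a₂ : A) : R :=
  (w i / (t i * Real.log 2)) •
    (Z i a₁ a₂ + star (Z i a₂ a₁) + (1 - t i) • (∑ a₃, star (Z i a₃ a₁) * Z i a₃ a₂) +
      (if a₁ = a₂ then 1 + t i • (∑ a₃, ∑ a₄, Z i a₃ a₄ * star (Z i a₃ a₄)) else 0))

/-- The matrix-valued noncommutative polynomial `P^(m)`. -/
def polyMatrix {A R : Type*} [Fintype A] [DecidableEq A] [Ring R] [StarRing R] [Algebra ℝ R]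
    {m : ℕ} (t w : Fin m → ℝ) (Z : Fin m → A → A → R) : Matrix A A R :=
  Matrix.of fun a₁ a₂ => ∑ i, polyEntry t w Z i a₁ a₂

/-- `P^(m)` evaluated at operators on `H`, as an operator on `A ⊗ H`. -/
def polyOp {A H : Type*} [Fintype A] [DecidableEq A] [Fintype H] [DecidableEq H] {m : ℕ}
    (t w : Fin m → ℝ) (Z : Fin m → A → A → Matrix H H ℂ) : Matrix (A × H) (A × H) ℂ :=
  Matrix.of fun p q => polyMatrix t w Z p.1 q.1 p.2 q.2

/-- The families `{Z_i[a,a'], Z_i[a,a']^*}` and `{Y_i[a,a'], Y_i[a,a']^*}` commute with each other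
(the remaining relations follow by taking adjoints). -/
def MutuallyCommute {A H : Type*} [Fintype H] {m : ℕ} (Z Y : Fin m → A → A → Matrix H H ℂ) :
    Prop :=
  ∀ (i j : Fin m) (a₁ a₂ a₃ a₄ : A),
    Commute (Y i a₁ a₂) (Z j a₃ a₄) ∧ Commute (Y i a₁ a₂) (star (Z j a₃ a₄))

end

end SqEnt

namespace SqEnt

open Matrix

/-! ### Variational formula for the divergence attached to a single node. -/

section Spectral

variable {ι : Type*} [Fintype ι] [DecidableEq ι]

/-! Two independent facts combine: a variational formula for each divergence, and the replacement of
commuting algebras on one space by algebras on two tensor factors.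

Variational formula. In eigenbases of ρ and σ, `nodeForm t ρ σ Z` splits into one scalar quadratic
per matrix entry of Z (`nodeForm_eq_sum`). Completing the square gives the minimum term by term, and
it is the summand of D_{f_t}(ρ‖σ) because l f_t(μ/l) = t⁻¹(l - l²/((1-t)l + tμ)). So D_{f_t} = min_Z
`nodeForm` whenever ker σ ⊆ ker ρ (`nodeDiv_le_nodeForm`, `exists_nodeForm_eq_nodeDiv`). For σ = I ⊗
τ_D the kernel condition always holds, which also removes the f(0⁺) term. Summing over nodes,
-D_f(τ‖I ⊗ τ_D) = min_Z tr(τ P(Z)).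

Commuting versus tensor. Given an extension by D ⊗ E, the optimal Z on D and Y on E become the
commuting families Z ⊗ 1 and 1 ⊗ Y (`exists_commuting_of_extension`). Conversely, for commuting
*-algebras 𝒜 ∋ Z and 𝒞 ∋ Y on H, the map x ⊗ a ⊗ c ↦ x ⊗ ac is a *-homomorphism on the span of these
products, so ω pulls back to a positive functional there, which a positive matrix Ω on A ⊗ B ⊗ H ⊗ H
represents (`exists_posSemidef_doubling`). Ω is an extension with the same values on P(Z) and P(Y),
hence its divergences bound the objective from below (`exists_extension_of_commuting`). -/

theorem eq_conj_diagonal_eigenvalues {ρ : Matrix ι ι ℂ} (hρ : ρ.IsHermitian) :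
    ρ = (hρ.eigenvectorUnitary : Matrix ι ι ℂ) * diagonal (fun j => (hρ.eigenvalues j : ℂ)) *
      (hρ.eigenvectorUnitary : Matrix ι ι ℂ)ᴴ := by
  conv_lhs => rw [hρ.spectral_theorem, Unitary.conjStarAlgAut_apply]
  rfl

theorem conjTranspose_mul_eigenvectorUnitary {ρ : Matrix ι ι ℂ} (hρ : ρ.IsHermitian) :
    (hρ.eigenvectorUnitary : Matrix ι ι ℂ)ᴴ * (hρ.eigenvectorUnitary : Matrix ι ι ℂ) = 1 :=
  Unitary.coe_star_mul_self hρ.eigenvectorUnitary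

theorem eigenvectorUnitary_mul_conjTranspose {ρ : Matrix ι ι ℂ} (hρ : ρ.IsHermitian) :
    (hρ.eigenvectorUnitary : Matrix ι ι ℂ) * (hρ.eigenvectorUnitary : Matrix ι ι ℂ)ᴴ = 1 :=
  Unitary.coe_mul_star_self hρ.eigenvectorUnitary

/-- The matrix of overlaps `⟨v_k, u_j⟩` of the eigenvectors of `σ` with those of `ρ`. -/
noncomputable def overlap {ρ σ : Matrix ι ι ℂ} (hρ : ρ.IsHermitian) (hσ : σ.IsHermitian) :
    Matrix ι ι ℂ :=
  (hσ.eigenvectorUnitary : Matrix ι ι ℂ)ᴴ * (hρ.eigenvectorUnitary : Matrix ι ι ℂ)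

theorem trace_specProj_mul_specProj {ρ σ : Matrix ι ι ℂ} (hρ : ρ.IsHermitian)
    (hσ : σ.IsHermitian) (j k : ι) :
    (specProj hρ j * specProj hσ k).trace.re = Complex.normSq (overlap hρ hσ k j) := by
  have h1 : overlap hρ hσ k j =
      ∑ x, star (hσ.eigenvectorBasis k x) * hρ.eigenvectorBasis j x := by
    simp [overlap, Matrix.mul_apply, IsHermitian.eigenvectorUnitary_apply]
  have h2 : (specProj hρ j * specProj hσ k).trace =
      star (overlap hρ hσ k j) * overlap hρ hσ k j := by
    rw [h1]
    simp only [specProj, trace, diag_apply, Matrix.mul_apply, vecMulVec_apply, star_sum, star_mul',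
      star_star, Finset.sum_mul_sum]
    rw [Finset.sum_comm]
    exact Finset.sum_congr rfl fun _ _ => Finset.sum_congr rfl fun _ _ => by ring
  rw [h2, Complex.star_def, ← Complex.normSq_eq_conj_mul_self, Complex.ofReal_re]

theorem re_trace_diagonal_mul (d : ι → ℝ) (X Y : Matrix ι ι ℂ) :
    (diagonal (fun j => (d j : ℂ)) * (Xᴴ * Y)).trace.re =
      ∑ j, ∑ k, d j * (star (X k j) * Y k j).re := by
  simp only [trace, diag_apply, diagonal_mul, Complex.re_sum, Complex.re_ofReal_mul]
  simp only [Matrix.mul_apply, conjTranspose_apply, Complex.re_sum, Finset.mul_sum]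

/-- With ρ u_j = λ_j u_j and v_k ∈ ker σ ⊆ ker ρ, one has λ_j ⟨u_j, v_k⟩ = ⟨u_j, ρ v_k⟩ = 0. -/
theorem overlap_eq_zero {ρ σ : Matrix ι ι ℂ} (hρ : ρ.IsHermitian) (hσ : σ.IsHermitian)
    (hker : ∀ v, σ *ᵥ v = 0 → ρ *ᵥ v = 0) {j k : ι} (hj : hρ.eigenvalues j ≠ 0)
    (hk : hσ.eigenvalues k = 0) : overlap hρ hσ k j = 0 := by
  have h1 : ρ *ᵥ (hσ.eigenvectorBasis k) = 0 := by
    apply hker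
    rw [hσ.mulVec_eigenvectorBasis, hk, zero_smul]
  have h2 : (overlap hρ hσ)ᴴ j k * hρ.eigenvalues j = 0 := by
    have h3 : (hρ.eigenvectorUnitary : Matrix ι ι ℂ)ᴴ *
        (ρ * (hσ.eigenvectorUnitary : Matrix ι ι ℂ)) =
        diagonal (fun j => (hρ.eigenvalues j : ℂ)) * (overlap hρ hσ)ᴴ := by
      conv_lhs => arg 2; arg 1; rw [eq_conj_diagonal_eigenvalues hρ]
      simp only [← Matrix.mul_assoc, conjTranspose_mul_eigenvectorUnitary, overlap,
        conjTranspose_mul, conjTranspose_conjTranspose, Matrix.one_mul]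
    have h4 := congrFun (congrFun h3 j) k
    rw [diagonal_mul] at h4
    rw [mul_comm, ← h4, Matrix.mul_apply]
    refine Finset.sum_eq_zero fun x _ => ?_
    have : (ρ * (hσ.eigenvectorUnitary : Matrix ι ι ℂ)) x k = 0 := by
      have := congrFun h1 x
      simpa [Matrix.mul_apply, mulVec, dotProduct, IsHermitian.eigenvectorUnitary_apply] using this
    rw [this, mul_zero]
  have h5 : (hρ.eigenvalues j : ℂ) ≠ 0 := by exact_mod_cast hj
  simpa [h5] using h2

/-- The complement of the support projector is spanned by eigenvectors in ker σ, which ρ kills. This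
is what makes the f(0⁺) term disappear, even if f(0⁺) is infinite. -/
theorem mul_one_sub_suppProj {ρ σ : Matrix ι ι ℂ} (hσ : σ.PosSemidef)
    (hker : ∀ v, σ *ᵥ v = 0 → ρ *ᵥ v = 0) : ρ * (1 - suppProj hσ.1) = 0 := by
  have h1 : (1 : Matrix ι ι ℂ) = ∑ k, specProj hσ.1 k := by
    rw [← eigenvectorUnitary_mul_conjTranspose hσ.1]
    ext x y
    simp [Matrix.mul_apply, Matrix.sum_apply, specProj, vecMulVec_apply,
      IsHermitian.eigenvectorUnitary_apply]
  rw [h1, suppProj, ← Finset.sum_sub_distrib, Finset.mul_sum]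
  refine Finset.sum_eq_zero fun k _ => ?_
  split_ifs with h
  · simp
  · have hk : hσ.1.eigenvalues k = 0 := le_antisymm (not_lt.1 h) (hσ.eigenvalues_nonneg k)
    rw [sub_zero, specProj, mul_vecMulVec]
    have : ρ *ᵥ (hσ.1.eigenvectorBasis k) = 0 := by
      apply hker
      rw [hσ.1.mulVec_eigenvectorBasis, hk, zero_smul]
    change vecMulVec (ρ *ᵥ (hσ.1.eigenvectorBasis k)) _ = 0
    rw [this, zero_vecMulVec]

/-- The objective function of the variational formula for `D_{f_t}(ρ‖σ)`. -/
noncomputable def nodeForm (t : ℝ) (ρ σ Z : Matrix ι ι ℂ) : ℝ :=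
  t⁻¹ * ((ρ * (1 + Z + Zᴴ + ((1 - t : ℝ) : ℂ) • (Zᴴ * Z))).trace + (t : ℂ) *
    (σ * (Z * Zᴴ)).trace).re

/-- The finite part of `D_{f_t}(ρ‖σ)`. -/
noncomputable def nodeDiv (t : ℝ) {ρ σ : Matrix ι ι ℂ} (hρ : ρ.IsHermitian) (hσ : σ.IsHermitian) :
    ℝ :=
  ∑ j, ∑ k, if 0 < hρ.eigenvalues j ∧ 0 < hσ.eigenvalues k then
      hρ.eigenvalues j * fNode t (hσ.eigenvalues k * (hρ.eigenvalues j)⁻¹) *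
        (specProj hρ j * specProj hσ k).trace.re
    else 0

/-- Writing Z from the eigenbasis of ρ to that of σ diagonalises both quadratic terms at once: Z*Z
is weighted by the eigenvalues of ρ and ZZ* by those of σ. The entries of W then decouple, and each
can be minimised alone. -/
theorem nodeForm_eq_sum (t : ℝ) {ρ σ : Matrix ι ι ℂ} (hρ : ρ.IsHermitian) (hσ : σ.IsHermitian)
    (W : Matrix ι ι ℂ) :
    nodeForm t ρ σ ((hσ.eigenvectorUnitary : Matrix ι ι ℂ) * W *
      (hρ.eigenvectorUnitary : Matrix ι ι ℂ)ᴴ) =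
      ∑ j, ∑ k, t⁻¹ * (hρ.eigenvalues j * Complex.normSq (overlap hρ hσ k j) +
        2 * hρ.eigenvalues j * (star (overlap hρ hσ k j) * W k j).re +
        ((1 - t) * hρ.eigenvalues j + t * hσ.eigenvalues k) * Complex.normSq (W k j)) := by
  have hCC : (overlap hρ hσ)ᴴ * overlap hρ hσ = 1 := by
    rw [overlap, conjTranspose_mul, conjTranspose_conjTranspose, Matrix.mul_assoc,
      ← Matrix.mul_assoc (hσ.eigenvectorUnitary : Matrix ι ι ℂ),
      eigenvectorUnitary_mul_conjTranspose, Matrix.one_mul, conjTranspose_mul_eigenvectorUnitary]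
  have hU := conjTranspose_mul_eigenvectorUnitary hρ
  have hV := conjTranspose_mul_eigenvectorUnitary hσ
  have hρe := eq_conj_diagonal_eigenvalues hρ
  have hσe := eq_conj_diagonal_eigenvalues hσ
  have hC : overlap hρ hσ = (hσ.eigenvectorUnitary : Matrix ι ι ℂ)ᴴ *
    (hρ.eigenvectorUnitary : Matrix ι ι ℂ) := rfl
  unfold nodeForm
  generalize overlap hρ hσ = C at *
  generalize hρ.eigenvalues = l at *
  generalize hσ.eigenvalues = μ at *
  generalize (hρ.eigenvectorUnitary : Matrix ι ι ℂ) = U at *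
  generalize (hσ.eigenvectorUnitary : Matrix ι ι ℂ) = V at *
  have hCt : Cᴴ = Uᴴ * V := by rw [hC, conjTranspose_mul, conjTranspose_conjTranspose]
  have e1 : ρ.trace.re = ∑ j, ∑ k, l j * (star (C k j) * C k j).re := by
    rw [← re_trace_diagonal_mul, hCC, hρe, trace_mul_comm, ← Matrix.mul_assoc, hU, Matrix.one_mul,
      Matrix.mul_one]
  have e2 : (ρ * (V * W * Uᴴ)).trace.re = ∑ j, ∑ k, l j * (star (C k j) * W k j).re := by
    rw [← re_trace_diagonal_mul, hCt, hρe, ← Matrix.mul_assoc, trace_mul_comm]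
    congr 2
    simp only [← Matrix.mul_assoc, hU, Matrix.one_mul]
  have e3 : (ρ * (V * W * Uᴴ)ᴴ).trace.re = (ρ * (V * W * Uᴴ)).trace.re := by
    have : (ρ * (V * W * Uᴴ)ᴴ).trace = star (ρ * (V * W * Uᴴ)).trace := by
      rw [← trace_conjTranspose, conjTranspose_mul ρ, hρ.eq, trace_mul_comm]
    rw [this, Complex.star_def, Complex.conj_re]
  have e4 : (ρ * ((V * W * Uᴴ)ᴴ * (V * W * Uᴴ))).trace.re =
      ∑ j, ∑ k, l j * (star (W k j) * W k j).re := by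
    rw [← re_trace_diagonal_mul, hρe, ← Matrix.mul_assoc, ← Matrix.mul_assoc,
      trace_mul_comm _ Uᴴ]
    congr 2
    simp only [conjTranspose_mul, conjTranspose_conjTranspose]
    simp only [← Matrix.mul_assoc, hU, Matrix.one_mul]
    rw [Matrix.mul_assoc _ Uᴴ U, hU, Matrix.mul_one, Matrix.mul_assoc _ Vᴴ V, hV, Matrix.mul_one]
  have e5 : (σ * ((V * W * Uᴴ) * (V * W * Uᴴ)ᴴ)).trace.re =
      ∑ j, ∑ k, μ k * (star (W k j) * W k j).re := by
    have : (diagonal (fun j => (μ j : ℂ)) * (Wᴴᴴ * Wᴴ)).trace.re =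
        ∑ j, ∑ k, μ k * (star (W k j) * W k j).re := by
      rw [re_trace_diagonal_mul, Finset.sum_comm]
      refine Finset.sum_congr rfl fun j _ => Finset.sum_congr rfl fun k _ => ?_
      rw [conjTranspose_apply, star_star, mul_comm (W k j)]
    rw [← this, hσe, ← Matrix.mul_assoc]
    simp only [conjTranspose_mul, conjTranspose_conjTranspose]
    simp only [← Matrix.mul_assoc]
    rw [trace_mul_comm _ Vᴴ]
    congr 2
    simp only [← Matrix.mul_assoc, hV, Matrix.one_mul]
    rw [Matrix.mul_assoc _ Vᴴ V, hV, Matrix.mul_one, Matrix.mul_assoc _ Uᴴ U, hU, Matrix.mul_one]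
  simp only [Matrix.mul_add, Matrix.mul_one, trace_add, Matrix.mul_smul, trace_smul, smul_eq_mul,
    Complex.add_re, Complex.re_ofReal_mul, e1, e2, e3, e4, e5]
  simp only [Finset.mul_sum, ← Finset.sum_add_distrib]
  refine Finset.sum_congr rfl fun j _ => Finset.sum_congr rfl fun k _ => ?_
  simp only [Complex.star_def, ← Complex.normSq_eq_conj_mul_self, Complex.ofReal_re]
  ring

theorem nodeDiv_eq_sum (t : ℝ) {ρ σ : Matrix ι ι ℂ} (hρ : ρ.IsHermitian) (hσ : σ.IsHermitian) :
    nodeDiv t hρ hσ = ∑ j, ∑ k, if 0 < hρ.eigenvalues j ∧ 0 < hσ.eigenvalues k then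
      hρ.eigenvalues j * fNode t (hσ.eigenvalues k * (hρ.eigenvalues j)⁻¹) *
        Complex.normSq (overlap hρ hσ k j) else 0 := by
  simp only [nodeDiv, trace_specProj_mul_specProj]

theorem eq_conj_eigenvectorUnitary {ρ σ : Matrix ι ι ℂ} (hρ : ρ.IsHermitian) (hσ : σ.IsHermitian)
    (Z : Matrix ι ι ℂ) : Z = (hσ.eigenvectorUnitary : Matrix ι ι ℂ) *
      ((hσ.eigenvectorUnitary : Matrix ι ι ℂ)ᴴ * Z * (hρ.eigenvectorUnitary : Matrix ι ι ℂ)) *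
      (hρ.eigenvectorUnitary : Matrix ι ι ℂ)ᴴ := by
  simp only [← Matrix.mul_assoc, eigenvectorUnitary_mul_conjTranspose, Matrix.one_mul]
  rw [Matrix.mul_assoc, eigenvectorUnitary_mul_conjTranspose, Matrix.mul_one]

theorem mul_fNode_eq {t l μ : ℝ} (ht : t ∈ Set.Ioc (0 : ℝ) 1) (hl : 0 < l) (hμ : 0 < μ) :
    l * fNode t (μ * l⁻¹) = t⁻¹ * (l - l ^ 2 / ((1 - t) * l + t * μ)) := by
  have hd : 0 < (1 - t) * l + t * μ :=
    add_pos_of_nonneg_of_pos (mul_nonneg (by linarith [ht.2]) hl.le) (mul_pos ht.1 hμ)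
  have e : t * (μ * l⁻¹ - 1) + 1 = ((1 - t) * l + t * μ) / l := by
    field_simp
    ring
  have ht0 : t ≠ 0 := ht.1.ne'
  rw [fNode, e]
  have hd' := hd.ne'
  generalize hdd : (1 - t) * l + t * μ = d at *
  field_simp
  rw [← hdd]
  ring

/-- The two sides differ by d⁻¹|lc + dw|². -/
theorem completed_square_le {l d : ℝ} (hd : 0 < d) (c w : ℂ) :
    (l - l ^ 2 / d) * Complex.normSq c ≤
      l * Complex.normSq c + 2 * l * (star c * w).re + d * Complex.normSq w := by
  have h : 0 ≤ d⁻¹ * Complex.normSq (l * c + d * w) :=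
    mul_nonneg (inv_nonneg.2 hd.le) (Complex.normSq_nonneg _)
  have e : d⁻¹ * Complex.normSq (l * c + d * w) =
      l ^ 2 / d * Complex.normSq c + 2 * l * (star c * w).re + d * Complex.normSq w := by
    simp only [Complex.normSq_apply, Complex.add_re, Complex.add_im,
      Complex.im_ofReal_mul, Complex.mul_re, Complex.ofReal_re, Complex.ofReal_im, Complex.star_def, Complex.conj_re, Complex.conj_im]
    field_simp
    ring
  rw [e] at h
  linarith

theorem nodeDiv_le_nodeForm {t : ℝ} (ht : t ∈ Set.Ioc (0 : ℝ) 1) {ρ σ : Matrix ι ι ℂ}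
    (hρ : ρ.PosSemidef) (hσ : σ.PosSemidef) (hker : ∀ v, σ *ᵥ v = 0 → ρ *ᵥ v = 0)
    (Z : Matrix ι ι ℂ) : nodeDiv t hρ.1 hσ.1 ≤ nodeForm t ρ σ Z := by
  rw [eq_conj_eigenvectorUnitary hρ.1 hσ.1 Z, nodeForm_eq_sum, nodeDiv_eq_sum]
  refine Finset.sum_le_sum fun j _ => Finset.sum_le_sum fun k _ => ?_
  generalize (_ * Z * _ : Matrix ι ι ℂ) k j = w
  have hti : 0 ≤ t⁻¹ := inv_nonneg.2 ht.1.le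
  have hl := hρ.eigenvalues_nonneg j
  have hμ := hσ.eigenvalues_nonneg k
  have hd : 0 ≤ (1 - t) * hρ.1.eigenvalues j + t * hσ.1.eigenvalues k :=
    add_nonneg (mul_nonneg (by linarith [ht.2]) hl) (mul_nonneg ht.1.le hμ)
  have hw := Complex.normSq_nonneg w
  split_ifs with h
  · rw [mul_fNode_eq ht h.1 h.2, mul_assoc]
    refine mul_le_mul_of_nonneg_left (completed_square_le ?_ _ _) hti
    exact add_pos_of_nonneg_of_pos (mul_nonneg (by linarith [ht.2]) hl) (mul_pos ht.1 h.2)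
  -- For a pair left out of the divergence either l = 0, or μ = 0 and the overlap vanishes; only the
  -- nonnegative term d|w|² survives.
  · refine mul_nonneg hti ?_
    rcases hl.eq_or_lt with h0 | h0
    · rw [← h0] at hd ⊢
      simpa using mul_nonneg hd hw
    · have : hσ.1.eigenvalues k = 0 := le_antisymm (not_lt.1 fun h' => h ⟨h0, h'⟩) hμ
      rw [overlap_eq_zero hρ.1 hσ.1 hker h0.ne' this]
      simpa using mul_nonneg hd hw

theorem exists_nodeForm_eq_nodeDiv {t : ℝ} (ht : t ∈ Set.Ioc (0 : ℝ) 1) {ρ σ : Matrix ι ι ℂ}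
    (hρ : ρ.PosSemidef) (hσ : σ.PosSemidef) (hker : ∀ v, σ *ᵥ v = 0 → ρ *ᵥ v = 0) :
    ∃ Z : Matrix ι ι ℂ, nodeForm t ρ σ Z = nodeDiv t hρ.1 hσ.1 := by
  -- Entrywise minimiser w = -(l/d)c, the zero of the completed square. Where d = 0 the quotient is
  -- 0 by convention, harmlessly: then lc = 0.
  refine ⟨(hσ.1.eigenvectorUnitary : Matrix ι ι ℂ) *
    (Matrix.of fun k j => ((-(hρ.1.eigenvalues j /
      ((1 - t) * hρ.1.eigenvalues j + t * hσ.1.eigenvalues k)) : ℝ) : ℂ) *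
        overlap hρ.1 hσ.1 k j) * (hρ.1.eigenvectorUnitary : Matrix ι ι ℂ)ᴴ, ?_⟩
  rw [nodeForm_eq_sum, nodeDiv_eq_sum]
  refine Finset.sum_congr rfl fun j _ => Finset.sum_congr rfl fun k _ => ?_
  have hl := hρ.eigenvalues_nonneg j
  have hμ := hσ.eigenvalues_nonneg k
  rw [of_apply]
  split_ifs with h
  · have hd : 0 < (1 - t) * hρ.1.eigenvalues j + t * hσ.1.eigenvalues k :=
      add_pos_of_nonneg_of_pos (mul_nonneg (by linarith [ht.2]) hl) (mul_pos ht.1 h.2)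
    rw [mul_fNode_eq ht h.1 h.2]
    generalize overlap hρ.1 hσ.1 k j = c
    generalize hρ.1.eigenvalues j = l at *
    generalize (1 - t) * l + t * hσ.1.eigenvalues k = d at *
    rw [mul_left_comm, Complex.re_ofReal_mul, map_mul, Complex.normSq_ofReal, Complex.star_def,
      ← Complex.normSq_eq_conj_mul_self, Complex.ofReal_re]
    field_simp
    ring
  · rcases hl.eq_or_lt with h0 | h0
    · simp [← h0]
    · have : hσ.1.eigenvalues k = 0 := le_antisymm (not_lt.1 fun h' => h ⟨h0, h'⟩) hμ
      rw [overlap_eq_zero hρ.1 hσ.1 hker h0.ne' this]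
      simp

end Spectral

/-! ### The case σ = I ⊗ τ_D. -/

section Conditional

variable {A D : Type*} [Fintype A] [DecidableEq A] [Fintype D]

/-- Write v = ∑ |a⟩ ⊗ v_a with τ_D v_a = 0. Then ∑_b ⟨b ⊗ v_a, τ (b ⊗ v_a)⟩ = ⟨v_a, τ_D v_a⟩ = 0 is
a sum of nonnegative terms, so τ kills every b ⊗ v_a. -/
theorem mulVec_eq_zero_of_one_kronecker_traceLeft {τ : Matrix (A × D) (A × D) ℂ}
    (hτ : τ.PosSemidef) (v : A × D → ℂ)
    (hv : ((1 : Matrix A A ℂ) ⊗ₖ traceLeft τ) *ᵥ v = 0) : τ *ᵥ v = 0 := by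
  classical
  -- `e b a` is the vector |b⟩ ⊗ v_a.
  let e : A → A → A × D → ℂ := fun b a p => if p.1 = b then v (a, p.2) else 0
  have h1 : ∀ a, traceLeft τ *ᵥ (fun d => v (a, d)) = 0 := by
    intro a
    ext d
    have := congrFun hv (a, d)
    simpa [mulVec, dotProduct, Fintype.sum_prod_type, one_apply] using this
  have h2 : ∀ a, ∑ b, star (e b a) ⬝ᵥ (τ *ᵥ e b a) = 0 := by
    intro a
    have h3 : star (fun d => v (a, d)) ⬝ᵥ (traceLeft τ *ᵥ (fun d => v (a, d))) = 0 := by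
      rw [h1, dotProduct_zero]
    have e1 : ∀ b p, (τ *ᵥ e b a) p = ∑ d, τ p (b, d) * v (a, d) := by
      intro b p
      simp only [mulVec, dotProduct, e, Fintype.sum_prod_type, mul_ite, mul_zero]
      rw [Finset.sum_comm]
      simp
    have e2 : ∀ b x, star (e b a) ⬝ᵥ x = ∑ d, star (v (a, d)) * x (b, d) := by
      intro b x
      simp only [dotProduct, e, Fintype.sum_prod_type, Pi.star_apply, apply_ite star, star_zero,
        ite_mul, zero_mul]
      rw [Finset.sum_comm]
      simp
    rw [← h3]
    simp only [e2, e1]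
    simp only [dotProduct, mulVec, Pi.star_apply, traceLeft, of_apply, Finset.sum_mul,
      Finset.mul_sum]
    rw [Finset.sum_comm]
    refine Finset.sum_congr rfl fun d _ => ?_
    rw [Finset.sum_comm]
  have h4 : ∀ b a, τ *ᵥ e b a = 0 := by
    intro b a
    rw [← hτ.dotProduct_mulVec_zero_iff]
    exact (Finset.sum_eq_zero_iff_of_nonneg fun b _ => hτ.dotProduct_mulVec_nonneg _).1 (h2 a) b
      (Finset.mem_univ b)
  have h5 : v = ∑ a, e a a := by
    ext p
    simp [e, Finset.sum_apply]
  rw [h5, mulVec_sum]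
  exact Finset.sum_eq_zero fun a _ => h4 a a

theorem trace_mul_one_kronecker (κ : Matrix (A × D) (A × D) ℂ) (X : Matrix D D ℂ) :
    (κ * ((1 : Matrix A A ℂ) ⊗ₖ X)).trace = (traceLeft κ * X).trace := by
  simp only [trace, diag_apply, Matrix.mul_apply, Fintype.sum_prod_type, kroneckerMap_apply,
    one_apply, traceLeft, of_apply, ite_mul, one_mul, zero_mul, mul_ite, mul_zero,
    Finset.sum_ite_irrel, Finset.sum_const_zero, Finset.sum_ite_eq', Finset.mem_univ, if_true,
    Finset.sum_mul]
  rw [Finset.sum_comm]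
  refine Finset.sum_congr rfl fun h _ => ?_
  rw [Finset.sum_comm]

/-- The real number `D_{f_t}(τ‖I_A ⊗ τ_D)`. -/
noncomputable def condNodeDiv [DecidableEq D] (t : ℝ) {τ : Matrix (A × D) (A × D) ℂ}
    (hτ : τ.PosSemidef) : ℝ :=
  nodeDiv t hτ.1 (one_kronecker_posSemidef (A := A) (traceLeft_posSemidef hτ)).1

theorem condDiv_rQuad [DecidableEq D] {m : ℕ} (t w : Fin m → ℝ) {τ : Matrix (A × D) (A × D) ℂ}
    (hτ : τ.PosSemidef) :
    condDiv (fun x => - (rQuad t w x / Real.log 2)) hτ =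
      ((-∑ i, w i / Real.log 2 * condNodeDiv (t i) hτ : ℝ) : EReal) := by
  rw [condDiv, fDiv, mul_one_sub_suppProj
    (one_kronecker_posSemidef (traceLeft_posSemidef hτ))
    (mulVec_eq_zero_of_one_kronecker_traceLeft hτ), trace_zero, Complex.zero_re, EReal.coe_zero,
    mul_zero, add_zero]
  congr 1
  simp only [condNodeDiv, nodeDiv, Finset.mul_sum, ← Finset.sum_neg_distrib]
  rw [Finset.sum_comm (s := (Finset.univ : Finset (Fin m)))]
  refine Finset.sum_congr rfl fun j _ => ?_
  rw [Finset.sum_comm (s := (Finset.univ : Finset (Fin m)))]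
  refine Finset.sum_congr rfl fun k _ => ?_
  split_ifs
  · simp only [rQuad, Finset.sum_div, mul_neg, neg_mul, Finset.mul_sum, Finset.sum_mul,
      ← Finset.sum_neg_distrib]
    exact Finset.sum_congr rfl fun i _ => by ring
  · simp

end Conditional

/-! ### The polynomial P as a sum of variational objectives. -/

section Polynomial

variable {A H : Type*} [Fintype A] [DecidableEq A] [Fintype H] [DecidableEq H]

/-- The operator on `A ⊗ H` with blocks `Z a a'`. -/
def ofBlocks {A H : Type*} (Z : A → A → Matrix H H ℂ) : Matrix (A × H) (A × H) ℂ :=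
  Matrix.of fun p q => Z p.1 q.1 p.2 q.2

theorem polyOp_eq_sum {m : ℕ} (t w : Fin m → ℝ) (Z : Fin m → A → A → Matrix H H ℂ) :
    polyOp t w Z = ∑ i, ((w i / (t i * Real.log 2) : ℝ) : ℂ) •
      (1 + ofBlocks (Z i) + (ofBlocks (Z i))ᴴ +
        ((1 - t i : ℝ) : ℂ) • ((ofBlocks (Z i))ᴴ * ofBlocks (Z i)) +
        (t i : ℂ) • ((1 : Matrix A A ℂ) ⊗ₖ traceLeft (ofBlocks (Z i) * (ofBlocks (Z i))ᴴ))) := by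
  ext ⟨a₁, h₁⟩ ⟨a₂, h₂⟩
  simp only [polyOp, polyMatrix, of_apply, Matrix.sum_apply]
  refine Finset.sum_congr rfl fun i _ => ?_
  simp only [polyEntry, Matrix.smul_apply, Matrix.add_apply, Complex.real_smul, smul_eq_mul]
  congr 1
  have e1 : (∑ a₃, star (Z i a₃ a₁) * Z i a₃ a₂) h₁ h₂ =
      ((ofBlocks (Z i))ᴴ * ofBlocks (Z i)) (a₁, h₁) (a₂, h₂) := by
    simp [Matrix.sum_apply, Matrix.mul_apply, ofBlocks, Fintype.sum_prod_type]
  have e2 : (∑ a₃, ∑ a₄, Z i a₃ a₄ * star (Z i a₃ a₄)) h₁ h₂ =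
      traceLeft (ofBlocks (Z i) * (ofBlocks (Z i))ᴴ) h₁ h₂ := by
    simp [Matrix.sum_apply, Matrix.mul_apply, ofBlocks, Fintype.sum_prod_type, traceLeft]
  have e3 : (if a₁ = a₂ then 1 + t i • (∑ a₃, ∑ a₄, Z i a₃ a₄ * star (Z i a₃ a₄)) else 0 :
      Matrix H H ℂ) h₁ h₂ = (1 : Matrix (A × H) (A × H) ℂ) (a₁, h₁) (a₂, h₂) + t i *
        ((1 : Matrix A A ℂ) ⊗ₖ traceLeft (ofBlocks (Z i) * (ofBlocks (Z i))ᴴ)) (a₁, h₁)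
          (a₂, h₂) := by
    rw [kroneckerMap_apply, ← e2]
    by_cases h : a₁ = a₂ <;> simp [h, one_apply]
  rw [e3, e1]
  simp only [ofBlocks, conjTranspose_apply, of_apply, star_apply]
  ring

theorem polyOp_isHermitian {m : ℕ} (t w : Fin m → ℝ) (Z : Fin m → A → A → Matrix H H ℂ) :
    (polyOp t w Z).IsHermitian := by
  have hsm : ∀ (r : ℝ) (n : Type _) (M : Matrix n n ℂ), M.IsHermitian →
      ((r : ℂ) • M).IsHermitian := fun r n M hM => by
    rw [IsHermitian, conjTranspose_smul, hM.eq, Complex.star_def, Complex.conj_ofReal]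
  rw [polyOp_eq_sum, IsHermitian, conjTranspose_sum]
  refine Finset.sum_congr rfl fun i _ => (hsm _ _ _ ?_).eq
  refine IsHermitian.add (IsHermitian.add ?_ (hsm _ _ _ (isHermitian_conjTranspose_mul_self _)))
    (hsm _ _ _ ?_)
  · rw [add_assoc]
    exact isHermitian_one.add (isHermitian_add_transpose_self _)
  · rw [IsHermitian, conjTranspose_kronecker, conjTranspose_one]
    congr 1
    ext h₁ h₂
    have := (isHermitian_mul_conjTranspose_self (ofBlocks (Z i))).apply
    simp only [conjTranspose_apply, traceLeft, of_apply, star_sum, this]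

/-- The δ-term of P is I ⊗ tr_A(ZZ*), and I ⊗ (·) is dual to tr_A under the trace pairing, so its
expectation in κ equals tr((I ⊗ κ_H) ZZ*), the σ-term of `nodeForm`. -/
theorem re_trace_mul_polyOp {m : ℕ} {t w : Fin m → ℝ} (ht : ∀ i, t i ≠ 0)
    (Z : Fin m → A → A → Matrix H H ℂ) (κ : Matrix (A × H) (A × H) ℂ) :
    (κ * polyOp t w Z).trace.re = ∑ i, w i / Real.log 2 *
      nodeForm (t i) κ ((1 : Matrix A A ℂ) ⊗ₖ traceLeft κ) (ofBlocks (Z i)) := by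
  rw [polyOp_eq_sum, Finset.mul_sum, trace_sum, Complex.re_sum]
  refine Finset.sum_congr rfl fun i _ => ?_
  rw [Matrix.mul_smul, trace_smul, smul_eq_mul, Complex.re_ofReal_mul, Matrix.mul_add, trace_add,
    Matrix.mul_smul κ (t i : ℂ), trace_smul, trace_mul_one_kronecker, smul_eq_mul, nodeForm,
    trace_mul_comm ((1 : Matrix A A ℂ) ⊗ₖ traceLeft κ), trace_mul_one_kronecker,
    trace_mul_comm (traceLeft κ), ← mul_assoc]
  congr 1
  have := ht i
  field_simp

theorem sum_condNodeDiv_le {m : ℕ} {t w : Fin m → ℝ} (ht : ∀ i, t i ∈ Set.Ioc (0 : ℝ) 1)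
    (hw : ∀ i, 0 < w i) (Z : Fin m → A → A → Matrix H H ℂ) {κ : Matrix (A × H) (A × H) ℂ}
    (hκ : κ.PosSemidef) :
    ∑ i, w i / Real.log 2 * condNodeDiv (t i) hκ ≤ (κ * polyOp t w Z).trace.re := by
  rw [re_trace_mul_polyOp fun i => (ht i).1.ne']
  refine Finset.sum_le_sum fun i _ => mul_le_mul_of_nonneg_left
    (nodeDiv_le_nodeForm (ht i) hκ (one_kronecker_posSemidef (traceLeft_posSemidef hκ)) (mulVec_eq_zero_of_one_kronecker_traceLeft hκ) _)
    (div_nonneg (hw i).le (Real.log_nonneg one_le_two))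

theorem exists_sum_condNodeDiv_eq {m : ℕ} {t w : Fin m → ℝ} (ht : ∀ i, t i ∈ Set.Ioc (0 : ℝ) 1)
    {κ : Matrix (A × H) (A × H) ℂ} (hκ : κ.PosSemidef) :
    ∃ Z : Fin m → A → A → Matrix H H ℂ,
      (κ * polyOp t w Z).trace.re = ∑ i, w i / Real.log 2 * condNodeDiv (t i) hκ := by
  choose Z hZ using fun i => exists_nodeForm_eq_nodeDiv (ht i) hκ
    (one_kronecker_posSemidef (A := A) (traceLeft_posSemidef hκ))
    (mulVec_eq_zero_of_one_kronecker_traceLeft hκ)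
  -- Any operator on A ⊗ H is a block family, so the optimisers of the separate nodes are all
  -- attained together.
  refine ⟨fun i a a' => Matrix.of fun h h' => Z i (a, h) (a', h'), ?_⟩
  rw [re_trace_mul_polyOp fun i => (ht i).1.ne']
  exact Finset.sum_congr rfl fun i _ => congrArg _ (hZ i)

end Polynomial

/-! ### Positive functionals on *-algebras of matrices. -/

section Representation

variable {N : Type*} [Fintype N] [DecidableEq N]

theorem aeval_eq_conj_diagonal {h : Matrix N N ℂ} (hh : h.IsHermitian) (p : Polynomial ℂ) :
    Polynomial.aeval h p = (hh.eigenvectorUnitary : Matrix N N ℂ) *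
      diagonal (fun j => p.eval (hh.eigenvalues j : ℂ)) *
        (hh.eigenvectorUnitary : Matrix N N ℂ)ᴴ := by
  have h1 : Polynomial.aeval (diagonal fun j => (hh.eigenvalues j : ℂ)) p =
      diagonal (fun j => p.eval (hh.eigenvalues j : ℂ)) := by
    have := Polynomial.aeval_algHom_apply (diagonalAlgHom ℂ : (N → ℂ) →ₐ[ℂ] Matrix N N ℂ)
      (fun j => (hh.eigenvalues j : ℂ)) p
    rw [Polynomial.aeval_pi_apply] at this
    simpa [Polynomial.coe_aeval_eq_eval] using this
  rw [← h1]
  conv_lhs => rw [hh.spectral_theorem]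
  exact Polynomial.aeval_algHom_apply
    ((Unitary.conjStarAlgAut ℂ (Matrix N N ℂ) hh.eigenvectorUnitary :
      Matrix N N ℂ ≃⋆ₐ[ℂ] Matrix N N ℂ).toAlgEquiv : Matrix N N ℂ →ₐ[ℂ] Matrix N N ℂ)
    (diagonal fun j => (hh.eigenvalues j : ℂ)) p

/-- The spectral projections of h are polynomials in h, hence lie in S. Testing with the projection
for an eigenvalue gives that eigenvalue times its multiplicity. -/
theorem posSemidef_of_trace_nonneg (S : Subalgebra ℂ (Matrix N N ℂ)) {h : Matrix N N ℂ}
    (hS : h ∈ S) (hh : h.IsHermitian) (hpos : ∀ s ∈ S, 0 ≤ (h * (sᴴ * s)).trace) :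
    h.PosSemidef := by
  rw [hh.posSemidef_iff_eigenvalues_nonneg]
  intro j
  -- The interpolant is 1 at the chosen eigenvalue and 0 at the others, so p(h) is the spectral
  -- projection.
  let p : Polynomial ℂ := Lagrange.interpolate
    (Finset.univ.image fun k => (hh.eigenvalues k : ℂ)) id
      (fun x => if x = hh.eigenvalues j then 1 else 0)
  have hp : ∀ k, p.eval (hh.eigenvalues k : ℂ) =
      if hh.eigenvalues k = hh.eigenvalues j then 1 else 0 := by
    intro k
    have := Lagrange.eval_interpolate_at_node (r := fun x : ℂ =>
      if x = hh.eigenvalues j then (1 : ℂ) else 0) (Set.injOn_id _)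
      (Finset.mem_image_of_mem (fun k => (hh.eigenvalues k : ℂ)) (Finset.mem_univ k))
    simpa [p] using this
  have hs : Polynomial.aeval h p ∈ S :=
    Algebra.adjoin_le (Set.singleton_subset_iff.2 hS) (Polynomial.aeval_mem_adjoin_singleton ℂ h)
  have h1 := hpos _ hs
  have h2 : h * ((Polynomial.aeval h p)ᴴ * Polynomial.aeval h p) =
      (hh.eigenvectorUnitary : Matrix N N ℂ) *
        (diagonal (fun k => if hh.eigenvalues k = hh.eigenvalues j then
          (hh.eigenvalues j : ℂ) else 0)) * (hh.eigenvectorUnitary : Matrix N N ℂ)ᴴ := by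
    rw [aeval_eq_conj_diagonal hh]
    have hU := conjTranspose_mul_eigenvectorUnitary hh
    have he := eq_conj_diagonal_eigenvalues hh
    simp only [hp]
    generalize hh.eigenvalues = l at *
    generalize (hh.eigenvectorUnitary : Matrix N N ℂ) = U at *
    rw [he]
    simp only [conjTranspose_mul, conjTranspose_conjTranspose, diagonal_conjTranspose]
    have hUr : ∀ X : Matrix N N ℂ, Uᴴ * (U * X) = X := fun X => by
      rw [← Matrix.mul_assoc, hU, Matrix.one_mul]
    simp only [Matrix.mul_assoc, hUr]
    congr 1
    simp only [← Matrix.mul_assoc, diagonal_mul_diagonal]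
    congr 2
    ext k
    by_cases hk : l k = l j <;> simp [hk]
  rw [h2, trace_mul_comm, ← Matrix.mul_assoc, conjTranspose_mul_eigenvectorUnitary, Matrix.one_mul,
    trace_diagonal, ← Finset.sum_filter, Finset.sum_const, nsmul_eq_mul] at h1
  have hc : (0 : ℝ) < (Finset.univ.filter fun k => hh.eigenvalues k = hh.eigenvalues j).card := by
    exact_mod_cast Finset.card_pos.2 ⟨j, by simp⟩
  have h3 : 0 ≤ ((Finset.univ.filter fun k => hh.eigenvalues k = hh.eigenvalues j).card : ℝ) *
      hh.eigenvalues j := by exact_mod_cast h1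
  exact nonneg_of_mul_nonneg_right h3 hc

/-- A positive functional on a `*`-algebra of matrices is represented by a positive semidefinite
matrix. -/
theorem exists_posSemidef_trace_eq (S : Subalgebra ℂ (Matrix N N ℂ)) (hS : ∀ s ∈ S, sᴴ ∈ S)
    (φ : Matrix N N ℂ →ₗ[ℂ] ℂ) (hstar : ∀ s ∈ S, φ sᴴ = star (φ s))
    (hpos : ∀ s ∈ S, 0 ≤ φ (sᴴ * s)) :
    ∃ h : Matrix N N ℂ, h.PosSemidef ∧ ∀ s ∈ S, (h * s).trace = φ s := by
  let T : S →ₗ[ℂ] Module.Dual ℂ S := LinearMap.mk₂ ℂ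
    (fun h s : S => ((h : Matrix N N ℂ) * (s : Matrix N N ℂ)).trace)
    (fun _ _ _ => by simp [Matrix.add_mul]) (fun _ _ _ => by simp)
    (fun _ _ _ => by simp [Matrix.mul_add]) (fun _ _ _ => by simp)
  have hT : ∀ h s : S, T h s = ((h : Matrix N N ℂ) * (s : Matrix N N ℂ)).trace := fun _ _ => rfl
  -- The trace pairing is nondegenerate on S since S contains h* along with h; a dimension count
  -- then makes every functional on S representable by an element of S.
  have hinj : Function.Injective T := by
    rw [← LinearMap.ker_eq_bot, LinearMap.ker_eq_bot']
    intro h hz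
    have := LinearMap.congr_fun hz ⟨(h : Matrix N N ℂ)ᴴ, hS _ h.2⟩
    rw [hT, LinearMap.zero_apply, trace_mul_conjTranspose_self_eq_zero_iff] at this
    exact Subtype.ext this
  have hsurj : Function.Surjective T :=
    (LinearMap.injective_iff_surjective_of_finrank_eq_finrank
      (Subspace.dual_finrank_eq (K := ℂ) (V := S)).symm).1 hinj
  obtain ⟨h, hh⟩ := hsurj (φ ∘ₗ S.val.toLinearMap)
  have hφ : ∀ s ∈ S, ((h : Matrix N N ℂ) * s).trace = φ s := fun s hs => by
    rw [← hT h ⟨s, hs⟩, hh]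
    rfl
  refine ⟨h, posSemidef_of_trace_nonneg S h.2 ?_ fun s hs => ?_, hφ⟩
  -- As φ respects adjoints, h* represents the same functional as h; uniqueness makes h Hermitian.
  · have : (⟨(h : Matrix N N ℂ)ᴴ, hS _ h.2⟩ : S) = h := by
      apply hinj
      ext s
      rw [hT, hT, hφ _ s.2, ← star_star (φ s), ← hstar _ s.2, ← hφ _ (hS _ s.2),
        ← trace_conjTranspose, conjTranspose_mul, conjTranspose_conjTranspose, trace_mul_comm]
    exact congrArg Subtype.val this
  · rw [hφ _ (S.mul_mem (hS _ hs) hs)]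
    exact hpos s hs

end Representation

/-! ### From commuting algebras on H to the two factors of H ⊗ H. -/

section Doubling

/-- The linear map `x ⊗ a ⊗ c ↦ x ⊗ ac`. -/
def collapse (K H : Type*) [Fintype H] :
    Matrix (K × (H × H)) (K × (H × H)) ℂ →ₗ[ℂ] Matrix (K × H) (K × H) ℂ where
  toFun X := Matrix.of fun p q => ∑ j, X (p.1, (p.2, j)) (q.1, (j, q.2))
  map_add' X Y := by
    ext p q
    simp [Finset.sum_add_distrib]
  map_smul' r X := by
    ext p q
    simp [Finset.mul_sum]

theorem collapse_kronecker {K H : Type*} [Fintype H] (x : Matrix K K ℂ) (a c : Matrix H H ℂ) :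
    collapse K H (x ⊗ₖ (a ⊗ₖ c)) = x ⊗ₖ (a * c) := by
  ext p q
  simp [collapse, kroneckerMap_apply, Matrix.mul_apply, Finset.mul_sum]

variable {K H : Type*} [Fintype K] [DecidableEq K] [Fintype H] [DecidableEq H]

/-- The products `x ⊗ a ⊗ c` with `a`, `c` in given algebras. -/
def productMonoid (K : Type*) [Fintype K] [DecidableEq K]
    (𝒜 𝒞 : StarSubalgebra ℝ (Matrix H H ℂ)) : Submonoid (Matrix (K × (H × H)) (K × (H × H)) ℂ) where
  carrier := {X | ∃ x : Matrix K K ℂ, ∃ a ∈ 𝒜, ∃ c ∈ 𝒞, X = x ⊗ₖ (a ⊗ₖ c)}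
  one_mem' := ⟨1, 1, one_mem 𝒜, 1, one_mem 𝒞, by simp⟩
  mul_mem' := by
    rintro _ _ ⟨x, a, ha, c, hc, rfl⟩ ⟨x', a', ha', c', hc', rfl⟩
    exact ⟨x * x', a * a', mul_mem ha ha', c * c', mul_mem hc hc', by
      simp only [mul_kronecker_mul]⟩

/-- X ↦ tr(ω · `collapse` X) is positive on the algebra S generated by the products x ⊗ a ⊗ c,
because `collapse` is a *-homomorphism there, though not on all matrices. Its representing matrix is
Ω. -/
theorem exists_posSemidef_doubling (𝒜 𝒞 : StarSubalgebra ℝ (Matrix H H ℂ))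
    (hcomm : ∀ a ∈ 𝒜, ∀ c ∈ 𝒞, c * a = a * c) {ω : Matrix (K × H) (K × H) ℂ} (hω : ω.PosSemidef) :
    ∃ Ω : Matrix (K × (H × H)) (K × (H × H)) ℂ, Ω.PosSemidef ∧
      ∀ (x : Matrix K K ℂ), ∀ a ∈ 𝒜, ∀ c ∈ 𝒞,
        (Ω * (x ⊗ₖ (a ⊗ₖ c))).trace = (ω * (x ⊗ₖ (a * c))).trace := by
  -- The products form a monoid, so S is their linear span and identities on S can be checked on
  -- products.
  let T := productMonoid K 𝒜 𝒞
  let S := Algebra.adjoin ℂ (T : Set (Matrix (K × (H × H)) (K × (H × H)) ℂ))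
  have hspan : ∀ s ∈ S, s ∈ Submodule.span ℂ
      (T : Set (Matrix (K × (H × H)) (K × (H × H)) ℂ)) := by
    intro s hs
    have : s ∈ Subalgebra.toSubmodule S := hs
    rwa [Algebra.adjoin_eq_span, Submonoid.closure_eq] at this
  have hTS : ∀ s ∈ Submodule.span ℂ (T : Set (Matrix (K × (H × H)) (K × (H × H)) ℂ)), s ∈ S :=
    fun s hs => Algebra.span_le_adjoin ℂ _ hs
  have hstar : ∀ s ∈ S, sᴴ ∈ S ∧ collapse K H sᴴ = (collapse K H s)ᴴ := by
    intro s hs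
    induction hspan s hs using Submodule.span_induction with
    | mem s h =>
      obtain ⟨x, a, ha, c, hc, rfl⟩ := h
      rw [conjTranspose_kronecker, conjTranspose_kronecker, collapse_kronecker, collapse_kronecker,
        conjTranspose_kronecker, conjTranspose_mul]
      exact ⟨Algebra.subset_adjoin ⟨xᴴ, aᴴ, star_mem ha, cᴴ, star_mem hc, rfl⟩, by
        rw [hcomm aᴴ (star_mem ha) cᴴ (star_mem hc)]⟩
    | zero => simp [S.zero_mem]
    | add s s' h h' ih ih' =>
      obtain ⟨h1, h2⟩ := ih (hTS s h)
      obtain ⟨h1', h2'⟩ := ih' (hTS s' h')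
      exact ⟨by simpa using S.add_mem h1 h1', by simp [h2, h2']⟩
    | smul r s h ih =>
      obtain ⟨h1, h2⟩ := ih (hTS s h)
      exact ⟨by simpa using S.smul_mem h1 (star r), by simp [h2]⟩
  -- On products this is (aa')(cc') = (ac)(a'c'), which uses that a' and c commute.
  have hmul : ∀ s ∈ S, ∀ s' ∈ S, collapse K H (s * s') = collapse K H s * collapse K H s' := by
    intro s hs s' hs'
    induction hspan s hs, hspan s' hs' using Submodule.span_induction₂ with
    | mem_mem s s' h h' =>
      obtain ⟨x, a, ha, c, hc, rfl⟩ := h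
      obtain ⟨x', a', ha', c', hc', rfl⟩ := h'
      simp only [← mul_kronecker_mul, collapse_kronecker]
      congr 1
      rw [Matrix.mul_assoc a, ← Matrix.mul_assoc a', ← hcomm a' ha' c hc]
      simp only [Matrix.mul_assoc]
    | zero_left => simp
    | zero_right => simp
    | add_left x y z hx hy hz h h' =>
      simp [Matrix.add_mul, h (hTS _ hx) (hTS _ hz), h' (hTS _ hy) (hTS _ hz)]
    | add_right x y z hx hy hz h h' =>
      simp [Matrix.mul_add, h (hTS _ hx) (hTS _ hy), h' (hTS _ hx) (hTS _ hz)]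
    | smul_left r x y hx hy h => simp [h (hTS _ hx) (hTS _ hy)]
    | smul_right r x y hx hy h => simp [h (hTS _ hx) (hTS _ hy)]
  let φ : Matrix (K × (H × H)) (K × (H × H)) ℂ →ₗ[ℂ] ℂ :=
    traceLinearMap (K × H) ℂ ℂ ∘ₗ LinearMap.mulLeft ℂ ω ∘ₗ collapse K H
  have hφ : ∀ X, φ X = (ω * collapse K H X).trace := fun X => rfl
  obtain ⟨Ω, hΩ, hΩφ⟩ := exists_posSemidef_trace_eq S (fun s hs => (hstar s hs).1) φ
    (fun s hs => by
      rw [hφ, hφ, (hstar s hs).2, ← trace_conjTranspose, conjTranspose_mul, hω.1.eq,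
        trace_mul_comm])
    (fun s hs => by
      rw [hφ, hmul _ (hstar s hs).1 _ hs, (hstar s hs).2, ← Matrix.mul_assoc, trace_mul_comm,
        ← Matrix.mul_assoc]
      exact (hω.mul_mul_conjTranspose_same _).trace_nonneg)
  refine ⟨Ω, hΩ, fun x a ha c hc => ?_⟩
  rw [hΩφ _ (Algebra.subset_adjoin ⟨x, a, ha, c, hc, rfl⟩), hφ, collapse_kronecker]

end Doubling

/-! ### Marginals as duals of tensoring with the identity. -/

section Marginals

theorem trace_submatrix_mul {I J : Type*} [Fintype I] [Fintype J] (e : I ≃ J) (κ X : Matrix J J ℂ) :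
    (κ.submatrix e e * X.submatrix e e).trace = (κ * X).trace := by
  rw [submatrix_mul_equiv]
  exact Equiv.sum_comp e fun j => (κ * X) j j

theorem trace_traceRight_mul {I J : Type*} [Fintype I] [Fintype J] [DecidableEq J]
    (Ω : Matrix (I × J) (I × J) ℂ) (X : Matrix I I ℂ) :
    (traceRight Ω * X).trace = (Ω * (X ⊗ₖ (1 : Matrix J J ℂ))).trace := by
  simp only [trace, diag_apply, Matrix.mul_apply, Fintype.sum_prod_type, kroneckerMap_apply,
    one_apply, traceRight, of_apply, mul_ite, mul_one, mul_zero, Finset.sum_ite_eq',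
    Finset.mem_univ, if_true, Finset.sum_mul]
  exact Finset.sum_congr rfl fun i _ => Finset.sum_comm

theorem trace_mul_single_apply {I : Type*} [Fintype I] [DecidableEq I] (M : Matrix I I ℂ)
    (i j : I) : (M * single j i (1 : ℂ)).trace = M i j := by
  simp [trace, Matrix.mul_apply, single_apply, ite_and]

variable {A B D E : Type*} [Fintype A] [Fintype B] [DecidableEq B] [Fintype D] [Fintype E]

theorem trace_marginalAH_mul_kronecker {H : Type*} [Fintype H]
    (ω : Matrix ((A × B) × H) ((A × B) × H) ℂ)
    (x : Matrix A A ℂ) (a : Matrix H H ℂ) :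
    (marginalAH ω * (x ⊗ₖ a)).trace = (ω * ((x ⊗ₖ (1 : Matrix B B ℂ)) ⊗ₖ a)).trace := by
  let e : (A × H) × B ≃ (A × B) × H :=
    ⟨fun p => ((p.1.1, p.2), p.1.2), fun p => ((p.1.1, p.2), p.1.2), fun _ => rfl, fun _ => rfl⟩
  rw [marginalAH, trace_traceRight_mul, ← trace_submatrix_mul e ω]
  congr 2
  ext p q
  simp [e, kroneckerMap_apply, mul_right_comm]

theorem trace_marginalAD_mul_kronecker [DecidableEq E]
    (ω : Matrix ((A × B) × (D × E)) ((A × B) × (D × E)) ℂ) (x : Matrix A A ℂ) (a : Matrix D D ℂ) :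
    (marginalAD ω * (x ⊗ₖ a)).trace =
      (ω * ((x ⊗ₖ (1 : Matrix B B ℂ)) ⊗ₖ (a ⊗ₖ (1 : Matrix E E ℂ)))).trace := by
  let e : (A × D) × E ≃ A × (D × E) :=
    ⟨fun p => (p.1.1, (p.1.2, p.2)), fun p => ((p.1, p.2.1), p.2.2), fun _ => rfl, fun _ => rfl⟩
  rw [← trace_marginalAH_mul_kronecker, marginalAD, trace_traceRight_mul,
    ← trace_submatrix_mul e (marginalAH ω)]
  congr 2
  ext p q
  simp [e, kroneckerMap_apply, mul_assoc]

theorem trace_marginalAE_mul_kronecker [DecidableEq D]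
    (ω : Matrix ((A × B) × (D × E)) ((A × B) × (D × E)) ℂ) (x : Matrix A A ℂ) (c : Matrix E E ℂ) :
    (marginalAE ω * (x ⊗ₖ c)).trace =
      (ω * ((x ⊗ₖ (1 : Matrix B B ℂ)) ⊗ₖ ((1 : Matrix D D ℂ) ⊗ₖ c))).trace := by
  let e : (A × E) × D ≃ A × (D × E) :=
    ⟨fun p => (p.1.1, (p.2, p.1.2)), fun p => ((p.1, p.2.2), p.2.1), fun _ => rfl, fun _ => rfl⟩
  rw [← trace_marginalAH_mul_kronecker, marginalAE, trace_traceRight_mul,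
    ← trace_submatrix_mul e (marginalAH ω)]
  congr 2
  ext p q
  simp [e, kroneckerMap_apply, mul_assoc, mul_comm]

end Marginals

/-! ### Naturality of P in the algebra of its variables. -/

section Polynomial

variable {A : Type*} [Fintype A] [DecidableEq A] {m : ℕ} (t w : Fin m → ℝ)

theorem polyMatrix_mem {R : Type*} [Ring R] [StarRing R] [Algebra ℝ R] [StarModule ℝ R]
    (𝒜 : StarSubalgebra ℝ R) {Z : Fin m → A → A → R} (hZ : ∀ i a a', Z i a a' ∈ 𝒜) (a₁ a₂ : A) :
    polyMatrix t w Z a₁ a₂ ∈ 𝒜 := by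
  have hZ' : ∀ i a a', star (Z i a a') ∈ 𝒜 := fun i a a' => star_mem (hZ i a a')
  simp only [polyMatrix, of_apply, polyEntry]
  refine sum_mem fun i _ => SMulMemClass.smul_mem _ (add_mem (add_mem (add_mem (hZ _ _ _)
    (hZ' _ _ _)) (SMulMemClass.smul_mem _ (sum_mem fun _ _ => mul_mem (hZ' _ _ _) (hZ _ _ _)))) ?_)
  split_ifs
  · exact add_mem (one_mem _) (SMulMemClass.smul_mem _ (sum_mem fun _ _ => sum_mem fun _ _ =>
      mul_mem (hZ _ _ _) (hZ' _ _ _)))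
  · exact zero_mem _

theorem polyMatrix_map {R R' : Type*} [Ring R] [StarRing R] [Algebra ℝ R] [Ring R'] [StarRing R']
    [Algebra ℝ R'] (π : R →⋆ₐ[ℝ] R') (Z : Fin m → A → A → R) (a₁ a₂ : A) :
    polyMatrix t w (fun i a a' => π (Z i a a')) a₁ a₂ = π (polyMatrix t w Z a₁ a₂) := by
  simp only [polyMatrix, polyEntry, of_apply, map_sum, map_smul, map_add, map_mul, map_star,
    apply_ite π, map_one, map_zero]

theorem polyOp_eq_sum_kronecker {H : Type*} [Fintype H] [DecidableEq H]
    (Z : Fin m → A → A → Matrix H H ℂ) :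
    polyOp t w Z = ∑ a, ∑ a', single a a' (1 : ℂ) ⊗ₖ polyMatrix t w Z a a' := by
  ext p q
  simp [polyOp, Matrix.sum_apply, single_apply, ite_and]

/-- Lets expectations be compared across different spaces H and H': P is a sum of matrix units
tensored with its entries. -/
theorem trace_mul_polyOp_congr {H H' : Type*} [Fintype H] [DecidableEq H] [Fintype H']
    [DecidableEq H'] {Z : Fin m → A → A → Matrix H H ℂ} {Z' : Fin m → A → A → Matrix H' H' ℂ}
    {κ : Matrix (A × H) (A × H) ℂ} {κ' : Matrix (A × H') (A × H') ℂ}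
    (h : ∀ (x : Matrix A A ℂ) a a', (κ * (x ⊗ₖ polyMatrix t w Z a a')).trace =
      (κ' * (x ⊗ₖ polyMatrix t w Z' a a')).trace) :
    (κ * polyOp t w Z).trace = (κ' * polyOp t w Z').trace := by
  simp only [polyOp_eq_sum_kronecker, Finset.mul_sum, trace_sum, h]

theorem re_trace_mul_half_smul_add {I : Type*} [Fintype I] (κ P Q : Matrix I I ℂ) :
    (κ * ((1 / 2 : ℂ) • (P + Q))).trace.re = 1 / 2 * ((κ * P).trace.re + (κ * Q).trace.re) := by
  have : (1 / 2 : ℂ) = ((1 / 2 : ℝ) : ℂ) := by norm_num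
  rw [this, Matrix.mul_smul, trace_smul, smul_eq_mul, Complex.re_ofReal_mul, Matrix.mul_add,
    trace_add, Complex.add_re]

end Polynomial

/-! ### Passage between extensions by D ⊗ E and commuting families. -/

section Extensions

/-- The `*`-homomorphism `a ↦ a ⊗ 1`. -/
def kroneckerOneHom (D E : Type*) [Fintype D] [DecidableEq D] [Fintype E] [DecidableEq E] :
    Matrix D D ℂ →⋆ₐ[ℝ] Matrix (D × E) (D × E) ℂ where
  toFun a := a ⊗ₖ (1 : Matrix E E ℂ)
  map_one' := one_kronecker_one
  map_mul' a b := by rw [← mul_kronecker_mul, Matrix.one_mul]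
  map_zero' := zero_kronecker _
  map_add' a b := add_kronecker _ _ _
  commutes' r := by
    rw [Algebra.algebraMap_eq_smul_one, Algebra.algebraMap_eq_smul_one, smul_kronecker,
      one_kronecker_one]
  map_star' a := by
    rw [star_eq_conjTranspose, star_eq_conjTranspose, conjTranspose_kronecker, conjTranspose_one]

/-- The `*`-homomorphism `c ↦ 1 ⊗ c`. -/
def oneKroneckerHom (D E : Type*) [Fintype D] [DecidableEq D] [Fintype E] [DecidableEq E] :
    Matrix E E ℂ →⋆ₐ[ℝ] Matrix (D × E) (D × E) ℂ where
  toFun c := (1 : Matrix D D ℂ) ⊗ₖ c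
  map_one' := one_kronecker_one
  map_mul' a b := by rw [← mul_kronecker_mul, Matrix.one_mul]
  map_zero' := kronecker_zero _
  map_add' a b := kronecker_add _ _ _
  commutes' r := by
    rw [Algebra.algebraMap_eq_smul_one, Algebra.algebraMap_eq_smul_one, kronecker_smul,
      one_kronecker_one]
  map_star' a := by
    rw [star_eq_conjTranspose, star_eq_conjTranspose, conjTranspose_kronecker, conjTranspose_one]

/-- Relabelling of the basis as a `*`-homomorphism. -/
def submatrixHom {I J : Type*} [Fintype I] [DecidableEq I] [Fintype J] [DecidableEq J] (e : I ≃ J) :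
    Matrix J J ℂ →⋆ₐ[ℝ] Matrix I I ℂ where
  toFun a := a.submatrix e e
  map_one' := submatrix_one_equiv e
  map_mul' a b := (submatrix_mul_equiv _ _ _ _ _).symm
  map_zero' := rfl
  map_add' a b := rfl
  commutes' r := by
    rw [Algebra.algebraMap_eq_smul_one, Algebra.algebraMap_eq_smul_one, submatrix_smul,
      Pi.smul_apply, Pi.smul_apply, submatrix_one_equiv]
  map_star' a := rfl

theorem IsExtension.submatrix {A B I J : Type*} [Fintype A] [Fintype B] [Fintype I]
    [Fintype J] (e : I ≃ J)
    {ρ : Matrix (A × B) (A × B) ℂ} {ω : Matrix ((A × B) × J) ((A × B) × J) ℂ}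
    (h : IsExtension ρ ω) :
    IsExtension ρ (ω.submatrix (Equiv.prodCongr (Equiv.refl _) e)
      (Equiv.prodCongr (Equiv.refl _) e)) := by
  refine ⟨⟨h.1.1.submatrix _, ?_⟩, ?_⟩
  · rw [← h.1.2]
    exact Equiv.sum_comp (Equiv.prodCongr (Equiv.refl (A × B)) e) fun j => ω j j
  · rw [← h.2]
    ext p q
    exact Equiv.sum_comp e fun k => ω (p, k) (q, k)

variable {A B : Type*} [Fintype A] [DecidableEq A] [Fintype B] {m : ℕ} (t w : Fin m → ℝ)

/-- An extension by `D ⊗ E` with optimal operators on `A ⊗ D` and `A ⊗ E` gives commuting families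
of operators on `D ⊗ E`. -/
theorem exists_commuting_of_extension (ht : ∀ i, t i ∈ Set.Ioc (0 : ℝ) 1) {dD dE : ℕ}
    {ρ : Matrix (A × B) (A × B) ℂ}
    {ω : Matrix ((A × B) × (Fin dD × Fin dE)) ((A × B) × (Fin dD × Fin dE)) ℂ}
    (h : IsExtension ρ ω) :
    ∃ ω' : Matrix ((A × B) × Fin (dD * dE)) ((A × B) × Fin (dD * dE)) ℂ, IsExtension ρ ω' ∧
      ∃ Z Y : Fin m → A → A → Matrix (Fin (dD * dE)) (Fin (dD * dE)) ℂ, MutuallyCommute Z Y ∧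
        (marginalAH ω' * polyOp t w Z).trace.re =
          ∑ i, w i / Real.log 2 * condNodeDiv (t i) (marginalAD_posSemidef h.1.1) ∧
        (marginalAH ω' * polyOp t w Y).trace.re =
          ∑ i, w i / Real.log 2 * condNodeDiv (t i) (marginalAE_posSemidef h.1.1) := by
  classical
  obtain ⟨Z, hZ⟩ := exists_sum_condNodeDiv_eq (w := w) ht (marginalAD_posSemidef h.1.1)
  obtain ⟨Y, hY⟩ := exists_sum_condNodeDiv_eq (w := w) ht (marginalAE_posSemidef h.1.1)
  -- The infimum runs over index types `Fin n`, so D ⊗ E is relabelled; both embeddings are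
  -- *-homomorphisms and hence commute with evaluating P.
  let e : Fin (dD * dE) ≃ Fin dD × Fin dE := finProdFinEquiv.symm
  let π₁ := (submatrixHom e).comp (kroneckerOneHom (Fin dD) (Fin dE))
  let π₂ := (submatrixHom e).comp (oneKroneckerHom (Fin dD) (Fin dE))
  have hcomm : ∀ a c, Commute (π₂ c) (π₁ a) := fun a c => by
    refine Commute.map (f := submatrixHom e) (?_ : Commute ((1 : Matrix (Fin dD) (Fin dD) ℂ) ⊗ₖ c)
      (a ⊗ₖ (1 : Matrix (Fin dE) (Fin dE) ℂ)))
    simp only [Commute, SemiconjBy, ← mul_kronecker_mul, Matrix.one_mul, Matrix.mul_one]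
  have htr : ∀ X x, (marginalAH (ω.submatrix (Equiv.prodCongr (Equiv.refl _) e)
      (Equiv.prodCongr (Equiv.refl _) e)) * (x ⊗ₖ submatrixHom e X)).trace =
      (ω * ((x ⊗ₖ (1 : Matrix B B ℂ)) ⊗ₖ X)).trace := fun X x => by
    rw [trace_marginalAH_mul_kronecker,
      ← trace_submatrix_mul (Equiv.prodCongr (Equiv.refl (A × B)) e) ω]
    rfl
  refine ⟨_, h.submatrix e, fun i a a' => π₁ (Z i a a'), fun i a a' => π₂ (Y i a a'),
    fun i j a₁ a₂ a₃ a₄ => ⟨hcomm _ _, ?_⟩, ?_, ?_⟩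
  · rw [← map_star]
    exact hcomm _ _
  · rw [← hZ]
    refine congrArg Complex.re (trace_mul_polyOp_congr t w fun x a a' => ?_)
    rw [polyMatrix_map, trace_marginalAD_mul_kronecker]
    exact htr _ _
  · rw [← hY]
    refine congrArg Complex.re (trace_mul_polyOp_congr t w fun x a a' => ?_)
    rw [polyMatrix_map, trace_marginalAE_mul_kronecker]
    exact htr _ _

/-- Commuting families of operators on `H` are realised, for the given state, by operators on the two
factors of `H ⊗ H`. -/
theorem exists_extension_of_commuting (ht : ∀ i, t i ∈ Set.Ioc (0 : ℝ) 1) (hw : ∀ i, 0 < w i)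
    {n : ℕ} {ρ : Matrix (A × B) (A × B) ℂ} {ω : Matrix ((A × B) × Fin n) ((A × B) × Fin n) ℂ}
    (h : IsExtension ρ ω) {Z Y : Fin m → A → A → Matrix (Fin n) (Fin n) ℂ}
    (hZY : MutuallyCommute Z Y) :
    ∃ (Ω : Matrix ((A × B) × (Fin n × Fin n)) ((A × B) × (Fin n × Fin n)) ℂ)
      (hΩ : IsExtension ρ Ω),
      ∑ i, w i / Real.log 2 * condNodeDiv (t i) (marginalAD_posSemidef hΩ.1.1) ≤
        (marginalAH ω * polyOp t w Z).trace.re ∧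
      ∑ i, w i / Real.log 2 * condNodeDiv (t i) (marginalAE_posSemidef hΩ.1.1) ≤
        (marginalAH ω * polyOp t w Y).trace.re := by
  classical
  -- 𝒞 is the commutant of the Z's and their adjoints, and 𝒜 its bicommutant: commuting *-algebras
  -- containing the Y's and the Z's respectively.
  let 𝒞 : StarSubalgebra ℝ (Matrix (Fin n) (Fin n) ℂ) :=
    StarSubalgebra.centralizer ℝ {X | ∃ i a a', X = Z i a a'}
  let 𝒜 : StarSubalgebra ℝ (Matrix (Fin n) (Fin n) ℂ) :=
    StarSubalgebra.centralizer ℝ (𝒞 : Set (Matrix (Fin n) (Fin n) ℂ))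
  have hY : ∀ i a a', Y i a a' ∈ 𝒞 := by
    intro i a a'
    rw [StarSubalgebra.mem_centralizer_iff]
    rintro _ ⟨j, b, b', rfl⟩
    exact ⟨(hZY i j a a' b b').1.symm, (hZY i j a a' b b').2.symm⟩
  have hZ : ∀ i a a', Z i a a' ∈ 𝒜 := by
    intro i a a'
    rw [StarSubalgebra.mem_centralizer_iff]
    intro g hg
    have hg' := star_mem hg
    exact ⟨((StarSubalgebra.mem_centralizer_iff ℝ).1 hg _ ⟨i, a, a', rfl⟩).1.symm,
      ((StarSubalgebra.mem_centralizer_iff ℝ).1 hg' _ ⟨i, a, a', rfl⟩).1.symm⟩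
  have hcomm : ∀ a ∈ 𝒜, ∀ c ∈ 𝒞, c * a = a * c := fun a ha c hc =>
    ((StarSubalgebra.mem_centralizer_iff ℝ).1 ha c hc).1
  obtain ⟨Ω, hΩ, htr⟩ := exists_posSemidef_doubling 𝒜 𝒞 hcomm h.1.1
  have hext : IsExtension ρ Ω := by
    refine ⟨⟨hΩ, ?_⟩, ?_⟩
    · have := htr 1 1 (one_mem _) 1 (one_mem _)
      rwa [one_kronecker_one, one_kronecker_one, Matrix.mul_one, Matrix.one_mul, one_kronecker_one,
        Matrix.mul_one, h.1.2] at this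
    · ext p q
      -- Testing against matrix units on A ⊗ B, with a = c = 1, recovers each entry of the marginal.
      have := htr (single q p 1) 1 (one_mem _) 1 (one_mem _)
      rwa [one_kronecker_one, Matrix.mul_one, ← trace_traceRight_mul, ← trace_traceRight_mul,
        trace_mul_single_apply, trace_mul_single_apply, h.2] at this
  refine ⟨Ω, hext, ?_, ?_⟩
  · refine (sum_condNodeDiv_le ht hw Z _).trans_eq ?_
    refine congrArg Complex.re (trace_mul_polyOp_congr t w fun x a a' => ?_)
    rw [trace_marginalAD_mul_kronecker, htr _ _ (polyMatrix_mem t w 𝒜 hZ a a') _ (one_mem _),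
      Matrix.mul_one, trace_marginalAH_mul_kronecker]
  · refine (sum_condNodeDiv_le ht hw Y _).trans_eq ?_
    refine congrArg Complex.re (trace_mul_polyOp_congr t w fun x a a' => ?_)
    rw [trace_marginalAE_mul_kronecker, htr _ _ (one_mem _) _ (polyMatrix_mem t w 𝒞 hY a a'),
      Matrix.one_mul, trace_marginalAH_mul_kronecker]

theorem neg_condDiv_sub_condDiv {D E : Type*} [Fintype D] [DecidableEq D] [Fintype E]
    [DecidableEq E] {τ : Matrix (A × D) (A × D) ℂ} {κ : Matrix (A × E) (A × E) ℂ}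
    (hτ : τ.PosSemidef) (hκ : κ.PosSemidef) :
    - condDiv (fun x => - (rQuad t w x / Real.log 2)) hτ -
      condDiv (fun x => - (rQuad t w x / Real.log 2)) hκ =
      ((∑ i, w i / Real.log 2 * condNodeDiv (t i) hτ +
        ∑ i, w i / Real.log 2 * condNodeDiv (t i) hκ : ℝ) : EReal) := by
  rw [condDiv_rQuad, condDiv_rQuad, ← EReal.coe_neg, ← EReal.coe_sub, neg_neg, sub_neg_eq_add]

end Extensions

end SqEnt

theorem mainTheorem3 {A B : Type*} [Fintype A] [DecidableEq A] [Fintype B]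
    (m : ℕ) (hm : 1 ≤ m) (t w : Fin m → ℝ)
    (ht : ∀ i, t i ∈ Set.Ioc (0 : ℝ) 1) (hw : ∀ i, 0 < w i) :
    (∀ (n : ℕ) (Z : Fin m → A → A → Matrix (Fin n) (Fin n) ℂ),
      (SqEnt.polyOp t w Z).IsHermitian) ∧
    ∀ ρ : Matrix (A × B) (A × B) ℂ, SqEnt.IsDensity ρ →
      SqEnt.mSquashed t w ρ =
        ⨅ (n : ℕ) (ω : Matrix ((A × B) × Fin n) ((A × B) × Fin n) ℂ)
          (_ : SqEnt.IsExtension ρ ω)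
          (Z : Fin m → A → A → Matrix (Fin n) (Fin n) ℂ)
          (Y : Fin m → A → A → Matrix (Fin n) (Fin n) ℂ)
          (_ : SqEnt.MutuallyCommute Z Y),
          (((SqEnt.marginalAH ω *
            ((1 / 2 : ℂ) • (SqEnt.polyOp t w Z + SqEnt.polyOp t w Y))).trace.re : ℝ) : EReal) := by
  refine ⟨fun n Z => SqEnt.polyOp_isHermitian t w Z, fun ρ _ => ?_⟩
  have h0 : (0 : EReal) ≤ ((1 / 2 : ℝ) : EReal) := by exact_mod_cast one_half_pos.le
  rw [SqEnt.mSquashed, SqEnt.fSquashed]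
  simp only [SqEnt.neg_condDiv_sub_condDiv]
  apply le_antisymm
  · refine le_iInf fun n => le_iInf fun ω => le_iInf fun h => le_iInf fun Z => le_iInf fun Y =>
      le_iInf fun hZY => ?_
    obtain ⟨Ω, hΩ, h1, h2⟩ := SqEnt.exists_extension_of_commuting t w ht hw h hZY
    refine (mul_le_mul_of_nonneg_left (iInf_le_of_le n (iInf_le_of_le n (iInf_le_of_le Ω
      (iInf_le _ hΩ)))) h0).trans ?_
    rw [SqEnt.re_trace_mul_half_smul_add, ← EReal.coe_mul, EReal.coe_le_coe_iff]
    linarith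
  -- Rewriting the right-hand infimum as ½·(2·inf) reduces the claim to 2·inf being a lower bound
  -- for every extension, without moving a factor through an infimum in `EReal`.
  · have h2 : ∀ x : EReal, x = ((1 / 2 : ℝ) : EReal) * (((2 : ℝ) : EReal) * x) := fun x => by
      rw [← mul_assoc, ← EReal.coe_mul]
      norm_num
    rw [h2 (iInf _)]
    refine mul_le_mul_of_nonneg_left (le_iInf fun dD => le_iInf fun dE => le_iInf fun ω =>
      le_iInf fun h => ?_) h0
    obtain ⟨ω', h', Z, Y, hZY, hZ, hY⟩ := SqEnt.exists_commuting_of_extension t w ht h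
    have h3 : (0 : EReal) ≤ ((2 : ℝ) : EReal) := by exact_mod_cast zero_le_two
    refine (mul_le_mul_of_nonneg_left (?_ : _ ≤ (((SqEnt.marginalAH ω' * ((1 / 2 : ℂ) •
      (SqEnt.polyOp t w Z + SqEnt.polyOp t w Y))).trace.re : ℝ) : EReal)) h3).trans ?_
    · exact iInf_le_of_le _ (iInf_le_of_le ω' (iInf_le_of_le h' (iInf_le_of_le Z
        (iInf_le_of_le Y (iInf_le_of_le hZY le_rfl)))))
    rw [SqEnt.re_trace_mul_half_smul_add, hZ, hY, ← EReal.coe_mul, EReal.coe_le_coe_iff]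
    linarith
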